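/- **Conventions.** A transformation $T$ of a probability space $(X,\mu)$ is a measure-preserving map $X\to X$ that is invertible on a set of full measure with measure-preserving inverse; relations between sets and between maps are understood up to null sets. A factor map from $(X,\mu,T)$ to $(Y,\nu,S)$ is a measure-preserving map $\phi:X\to Y$ with $\phi\circ T=S\circ\phi$ almost everywhere, and $T$ factors onto $S$ if such a map exists. For $k\ge 1$, $\mathbb Z/k\mathbb Z$ also denotes the transformation $i\mapsto i+1$ of $\mathbb Z/k\mathbb Z$ with the uniform probability measure. $T$ is rank-one if there are integers $r_n>1$ ($n\ge 0$) and $s_{n,i}\ge 0$ ($0<i\le r_n$) such that, with $h_0=1$ and $h_{n+1}=r_nh_n+\sum_{0<i\le r_n}s_{n,i}$, one has $\sum_n (h_{n+1}-r_nh_n)/h_{n+1}<\infty$, and there are measurable sets $B_n$, $B_{n,i}$ ($0<i\le r_n$), $C_{n,i,j}$ ($0<i\le r_n$, $0<j\le s_{n,i}$) such that for all $n$: $\{B_{n,i}:0<i\le r_n\}$ is a partition of $B_n$; the sets $T^k(B_n)$, $0\le k<h_n$, are disjoint; $T^{h_n}(B_{n,i})=C_{n,i,1}$ if $s_{n,i}\ne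 0$; $T^{h_n}(B_{n,i})=B_{n,i+1}$ if $s_{n,i}=0$ and $i<r_n$; $T(C_{n,i,j})=C_{n,i,j+1}$ if $j<s_{n,i}$; $T(C_{n,i,s_{n,i}})=B_{n,i+1}$ if $s_{n,i}\neq 0$ and $i<r_n$; $B_{n+1}=B_{n,1}$; and every measurable set can be approximated arbitrarily well in measure by a union of some of the levels $B_n,T(B_n),\dots,T^{h_n-1}(B_n)$ of a single tower, for some $n$. For such data and $n\ge m$ put $$I_{m,n}=\{\,i : 0\le i<h_n,\ T^i(B_n)\subseteq B_m\,\}.$$ Given integers $k_n>1$ ($n\ge 0$) with $k_n\mid k_{n+1}$, let $K=\{m : m\mid k_n \text{ for some } n\}$. The odometer $\mathcal O_K$ is the map $(\alpha_n)_n\mapsto(\alpha_n+1)_n$ on the space of sequences $\alpha\in\prod_n\mathbb Z/k_n\mathbb Z$ with $\alpha_n\equiv\alpha_m \pmod{k_m}$ for $m\le n$, with the probability measure giving each set $\{\alpha:\alpha_n=i\}$ measure $1/k_n$. **Theorem.** Let $T$ be a rank-one transformation of a probability space $(X,\mu)$ (for example, of a standard Lebesgue space), with data as above, and let $\mathcal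 O_K$ be an odometer as above. The following are equivalent. 1. $T$ factors onto $\mathcal O_K$. 2. For every $k\in K$ and every $\eta>0$ there is $N\in\mathbb N$ such that for all $n\ge m\ge N$ there is $j\in\mathbb Z/k\mathbb Z$ with $$\frac{|\{i\in I_{m,n} : i\not\equiv j \bmod k\}|}{|I_{m,n}|}<\eta .$$ 3. $T$ factors onto $\mathbb Z/k\mathbb Z$ for every $k\in K$. -/

import Mathlib

open MeasureTheory Set
open scoped ENNReal

namespace RankOne

/-! ### Measure-preserving transformations and factor maps -/

/-- A transformation of a measure space `(X, μ)`: a measure-preserving map which is invertible up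
to a null set, together with its (almost everywhere unique) measure-preserving inverse. -/
structure Transformation {X : Type*} [MeasurableSpace X] (μ : Measure X) where
  toFun : X → X
  invFun : X → X
  measurePreserving_toFun : MeasurePreserving toFun μ μ
  measurePreserving_invFun : MeasurePreserving invFun μ μ
  left_inv : ∀ᵐ x ∂μ, invFun (toFun x) = x
  right_inv : ∀ᵐ x ∂μ, toFun (invFun x) = x

/-- The set `T ^ i (A)`.  It is written as the preimage of `A` under the `i`-th iterate of the
inverse of `T`, so that, as is meant in ergodic theory, it depends only on `A` and `T` up to
null sets; on a `T`-invariant set of full measure on which `T` is a genuine bijection it is the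
direct image of `A` under the `i`-th iterate of `T`. -/
def Transformation.iterImage {X : Type*} [MeasurableSpace X] {μ : Measure X}
    (T : Transformation μ) (i : ℕ) (A : Set X) : Set X :=
  T.invFun^[i] ⁻¹' A

/-- `φ` is a factor map from `T` to `S`: it is measure-preserving and `φ ∘ T = S ∘ φ` almost
everywhere. -/
structure IsFactorMap {X Y : Type*} [MeasurableSpace X] [MeasurableSpace Y]
    {μ : Measure X} {ν : Measure Y} (T : Transformation μ) (S : Transformation ν)
    (φ : X → Y) : Prop where
  measurePreserving : MeasurePreserving φ μ ν
  semiconj : ∀ᵐ x ∂μ, φ (T.toFun x) = S.toFun (φ x)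

/-- `T` factors onto `S`. -/
def Transformation.FactorsOnto {X Y : Type*} [MeasurableSpace X] [MeasurableSpace Y]
    {μ : Measure X} {ν : Measure Y} (T : Transformation μ) (S : Transformation ν) : Prop :=
  ∃ φ : X → Y, IsFactorMap T S φ

/-! ### Rank-one transformations -/

/-- The heights of the towers: `h 0 = 1` and `h (n + 1) = r n * h n + ∑ 0 < i ≤ r n, s n i`. -/
def height (r : ℕ → ℕ) (s : ℕ → ℕ → ℕ) : ℕ → ℕ
  | 0 => 1
  | n + 1 => r n * height r s n + ∑ i ∈ Finset.Icc 1 (r n), s n i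

/-- A cutting and stacking construction that exhibits `T` as a rank-one transformation.
`r` is the cutting parameter, `s` the spacer parameter, `B n` is the base of the stage-`n` tower,
the sets `Bsub n i` (`0 < i ≤ r n`) are the pieces into which `B n` is cut, and the sets `C n i j`
(`0 < j ≤ s n i`) are the spacers over the `i`-th piece.  Values at other indices play no role.
All relations between sets are understood up to null sets. -/
structure Construction {X : Type*} [MeasurableSpace X] {μ : Measure X}
    (T : Transformation μ) where
  r : ℕ → ℕ
  s : ℕ → ℕ → ℕ
  B : ℕ → Set X
  Bsub : ℕ → ℕ → Set X
  C : ℕ → ℕ → ℕ → Set X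
  one_lt_r : ∀ n, 1 < r n
  summable_spacers : Summable fun n : ℕ =>
    ((height r s (n + 1) : ℝ) - (r n : ℝ) * (height r s n : ℝ)) / (height r s (n + 1) : ℝ)
  nullMeasurableSet_B : ∀ n, NullMeasurableSet (B n) μ
  nullMeasurableSet_Bsub : ∀ n i, 0 < i → i ≤ r n → NullMeasurableSet (Bsub n i) μ
  nullMeasurableSet_C : ∀ n i j, 0 < i → i ≤ r n → 0 < j → j ≤ s n i →
    NullMeasurableSet (C n i j) μ
  /-- The sets `Bsub n i`, `0 < i ≤ r n`, form a partition of `B n`. -/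
  iUnion_Bsub : ∀ n, (⋃ i ∈ Finset.Icc 1 (r n), Bsub n i) =ᵐ[μ] B n
  aedisjoint_Bsub : ∀ n i i', 0 < i → i ≤ r n → 0 < i' → i' ≤ r n → i ≠ i' →
    AEDisjoint μ (Bsub n i) (Bsub n i')
  /-- The levels of the stage-`n` tower are disjoint. -/
  aedisjoint_levels : ∀ n k k', k < height r s n → k' < height r s n → k ≠ k' →
    AEDisjoint μ (T.iterImage k (B n)) (T.iterImage k' (B n))
  iterImage_Bsub_of_spacer : ∀ n i, 0 < i → i ≤ r n → s n i ≠ 0 →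
    T.iterImage (height r s n) (Bsub n i) =ᵐ[μ] C n i 1
  iterImage_Bsub_of_no_spacer : ∀ n i, 0 < i → i < r n → s n i = 0 →
    T.iterImage (height r s n) (Bsub n i) =ᵐ[μ] Bsub n (i + 1)
  image_C : ∀ n i j, 0 < i → i ≤ r n → 0 < j → j < s n i →
    T.iterImage 1 (C n i j) =ᵐ[μ] C n i (j + 1)
  image_last_C : ∀ n i, 0 < i → i < r n → s n i ≠ 0 →
    T.iterImage 1 (C n i (s n i)) =ᵐ[μ] Bsub n (i + 1)
  base_succ : ∀ n, B (n + 1) =ᵐ[μ] Bsub n 1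
  /-- The levels are dense in the `σ`-algebra: every measurable set is approximated in measure by
  unions of levels of a tower. -/
  dense_levels : ∀ A : Set X, MeasurableSet A → ∀ ε : ℝ≥0∞, 0 < ε →
    ∃ n : ℕ, ∃ J ⊆ Finset.range (height r s n),
      μ (symmDiff A (⋃ i ∈ J, T.iterImage i (B n))) < ε

/-- The height `h n` of the stage-`n` tower. -/
def Construction.h {X : Type*} [MeasurableSpace X] {μ : Measure X} {T : Transformation μ}
    (D : Construction T) (n : ℕ) : ℕ :=
  height D.r D.s n

open Classical in
/-- The set `I_{m,n} = {i : T ^ i (B n) ⊆ B m, 0 ≤ i < h n}` of indices of the levels of the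
stage-`n` tower that make up the base of the stage-`m` tower. -/
noncomputable def Construction.I {X : Type*} [MeasurableSpace X] {μ : Measure X}
    {T : Transformation μ} (D : Construction T) (m n : ℕ) : Finset ℕ :=
  (Finset.range (D.h n)).filter fun i => T.iterImage i (D.B n) ≤ᵐ[μ] D.B m

/-! ### Finite cyclic permutations -/

/-- The measure on `ℤ / kℤ` that gives mass `1 / k` to each point. -/
noncomputable def cyclicMeasure (k : ℕ) : Measure (ZMod k) :=
  (k : ℝ≥0∞)⁻¹ • Measure.count

/-- The finite cyclic permutation `i ↦ i + 1` of `ℤ / kℤ`. -/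
noncomputable def cyclic (k : ℕ) : Transformation (cyclicMeasure k) where
  toFun i := i + 1
  invFun i := i - 1
  measurePreserving_toFun :=
    (measurePreserving_add_right (Measure.count : Measure (ZMod k)) 1).smul_measure _
  measurePreserving_invFun :=
    (measurePreserving_sub_right (Measure.count : Measure (ZMod k)) 1).smul_measure _
  left_inv := Filter.Eventually.of_forall fun i => add_sub_cancel_right i 1
  right_inv := Filter.Eventually.of_forall fun i => sub_add_cancel i 1

/-! ### Odometers -/

/-- A sequence of integers greater than `1`, each of which divides the next one. -/
structure OdometerSeq where
  k : ℕ → ℕ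
  one_lt : ∀ n, 1 < k n
  dvd_succ : ∀ n, k n ∣ k (n + 1)

theorem OdometerSeq.dvd_of_le (κ : OdometerSeq) {m n : ℕ} (h : m ≤ n) : κ.k m ∣ κ.k n := by
  induction n, h using Nat.le_induction with
  | base => exact dvd_rfl
  | succ n _ ih => exact ih.trans (κ.dvd_succ n)

instance (κ : OdometerSeq) (n : ℕ) : NeZero (κ.k n) :=
  ⟨(zero_lt_one.trans (κ.one_lt n)).ne'⟩

/-- The underlying space of the odometer: the sequences `α ∈ ∏ ℤ / k_n ℤ` such that the reduction
of `α n` modulo `k m` is `α m` for `m ≤ n`.  It is a closed subgroup of the compact product group,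
and carries the subspace topology and the product `σ`-algebra. -/
def OdometerSeq.space (κ : OdometerSeq) : AddSubgroup (∀ n, ZMod (κ.k n)) where
  carrier := {α | ∀ m n, ∀ h : m ≤ n,
    ZMod.castHom (κ.dvd_of_le h) (ZMod (κ.k m)) (α n) = α m}
  zero_mem' := fun m n h => map_zero _
  add_mem' := fun {a b} ha hb m n h => by
    rw [Pi.add_apply, map_add, ha m n h, hb m n h, Pi.add_apply]
  neg_mem' := fun {a} ha m n h => by
    rw [Pi.neg_apply, map_neg, ha m n h, Pi.neg_apply]

instance instBorelSpaceZMod (k : ℕ) : BorelSpace (ZMod k) :=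
  ⟨by rw [borel_eq_top_of_discrete]; rfl⟩

theorem OdometerSeq.isClosed_space (κ : OdometerSeq) :
    IsClosed (κ.space : Set (∀ n, ZMod (κ.k n))) := by
  have : (κ.space : Set (∀ n, ZMod (κ.k n))) = ⋂ m, ⋂ n, ⋂ h : m ≤ n,
      {α | ZMod.castHom (κ.dvd_of_le h) (ZMod (κ.k m)) (α n) = α m} := by
    ext α
    simp [OdometerSeq.space]
  rw [this]
  refine isClosed_iInter fun m => isClosed_iInter fun n => isClosed_iInter fun h => ?_
  exact isClosed_eq
    ((continuous_of_discreteTopology (f := ZMod.castHom (κ.dvd_of_le h) (ZMod (κ.k m)))).comp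
      (continuous_apply n)) (continuous_apply m)

instance (κ : OdometerSeq) : CompactSpace κ.space :=
  isCompact_iff_compactSpace.1 κ.isClosed_space.isCompact

/-- The natural measure on the odometer: the Haar probability measure. -/
noncomputable def OdometerSeq.measure (κ : OdometerSeq) : Measure κ.space :=
  Measure.addHaarMeasure ⊤

instance (κ : OdometerSeq) : κ.measure.IsAddHaarMeasure :=
  inferInstanceAs (Measure.addHaarMeasure ⊤).IsAddHaarMeasure

/-- The element `(1, 1, 1, …)`. -/
def OdometerSeq.one (κ : OdometerSeq) : κ.space :=
  ⟨fun _ => 1, fun _ _ _ => map_one _⟩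

/-- The odometer: `α ↦ (α 0 + 1, α 1 + 1, …)`. -/
noncomputable def odometer (κ : OdometerSeq) : Transformation κ.measure where
  toFun α := α + κ.one
  invFun α := α - κ.one
  measurePreserving_toFun := measurePreserving_add_right _ _
  measurePreserving_invFun := measurePreserving_sub_right _ _
  left_inv := Filter.Eventually.of_forall fun α => add_sub_cancel_right α κ.one
  right_inv := Filter.Eventually.of_forall fun α => sub_add_cancel α κ.one

/-- The defining property of the natural measure: each set `{α | α n = i}` has measure
`1 / k n`. -/
theorem OdometerSeq.measure_cylinder (κ : OdometerSeq) (n : ℕ) (i : ZMod (κ.k n)) :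
    κ.measure {α : κ.space | α.1 n = i} = (κ.k n : ℝ≥0∞)⁻¹ := by
  have hms : ∀ j : ZMod (κ.k n), MeasurableSet {α : κ.space | α.1 n = j} := fun j =>
    measurableSet_eq_fun ((measurable_pi_apply n).comp measurable_subtype_coe) measurable_const
  have heq : ∀ j : ZMod (κ.k n), κ.measure {α : κ.space | α.1 n = j} =
      κ.measure {α : κ.space | α.1 n = i} := by
    intro j
    have hg : ((((i - j).val • κ.one : κ.space)).1 n : ZMod (κ.k n)) = i - j := by
      simp [OdometerSeq.one]
    have := (measurePreserving_add_right κ.measure ((i - j).val • κ.one)).measure_preimage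
      (hms i).nullMeasurableSet
    rw [← this]
    congr 1
    ext α
    simp only [mem_ofPred_eq, mem_preimage, AddSubgroup.coe_add, Pi.add_apply]
    rw [hg]
    constructor
    · intro h
      rw [h]
      ring
    · intro h
      linear_combination h
  have huniv : κ.measure univ = 1 := by
    have := Measure.addHaarMeasure_self
      (K₀ := (⊤ : TopologicalSpace.PositiveCompacts κ.space))
    simpa [OdometerSeq.measure] using this
  have hsum : κ.measure univ =
      ∑ j : ZMod (κ.k n), κ.measure {α : κ.space | α.1 n = j} := by
    rw [← measure_biUnion_finset]
    · congr 1
      ext α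
      simp
    · intro a _ b _ hab
      exact Set.disjoint_left.2 fun α (h1 : α.1 n = a) (h2 : α.1 n = b) => hab (h1.symm.trans h2)
    · exact fun j _ => hms j
  rw [huniv, Finset.sum_congr rfl fun j _ => heq j, Finset.sum_const, Finset.card_univ,
    ZMod.card, nsmul_eq_mul] at hsum
  exact ENNReal.eq_inv_of_mul_eq_one_left (by rw [mul_comm]; exact hsum.symm)

end RankOne

/-! Write `b_n` for the measure of `B n`. Factoring onto `ℤ/k` amounts to having a measurable `φ : X
→ ZMod k` with `φ ∘ T = φ + 1` a.e.: `T` permutes the fibres cyclically, so they automatically have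
equal mass.

From `φ` to the arithmetic condition: high towers approximate the set `φ = 0`, while the part of the
`i`-th level on which `φ = 0` is a translate of the part of the base on which `φ = -i`. Hence every
fibre of `φ` occupies almost none or almost all of `B n`, and `φ` is nearly a constant `c_n` there
(`IsEquivariant.exists_concentrated`). Level `i` of tower `n` then mostly carries the value `c_n +
i`; if it lies in `B m`, where `φ` is mostly `c_m`, then typically `i ≡ c_m - c_n`
(`IsEquivariant.card_filter_lt`).

Conversely, let `ψ_n` be the height in tower `n` modulo `k`. It is equivariant off a small set, and
the condition says that `ψ_n - ψ_m` is nearly constant. After correction by constants, a fast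
subsequence converges a.e. by Borel–Cantelli to an equivariant map (`exists_isEquivariant`).

For the odometer, `T` is ergodic (`Construction.ergodic`), so two equivariant maps to `ℤ/k` differ
by a constant. The maps to the various `ℤ/k_n` can therefore be translated into a compatible
sequence (`IsEquivariant.exists_lift`), which is a map to the inverse limit; its law is determined
on cylinders (`factorsOnto_odometer`). -/

namespace RankOne

/-! ### Images of sets and the combinatorics of the towers, up to null sets. -/

section Basic

variable {X : Type*} [MeasurableSpace X] {μ : Measure X}

namespace Transformation

variable (T : Transformation μ)

theorem iterImage_iterImage (i j : ℕ) (A : Set X) :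
    T.iterImage i (T.iterImage j A) = T.iterImage (j + i) A := by
  simp only [iterImage, Function.iterate_add, preimage_comp]

theorem measurePreserving_iterate (i : ℕ) : MeasurePreserving (T.invFun^[i]) μ μ :=
  T.measurePreserving_invFun.iterate i

variable {T}

theorem iterImage_ae_eq (i : ℕ) {A B : Set X} (h : A =ᵐ[μ] B) :
    T.iterImage i A =ᵐ[μ] T.iterImage i B :=
  (T.measurePreserving_iterate i).quasiMeasurePreserving.preimage_ae_eq h

theorem nullMeasurableSet_iterImage (i : ℕ) {A : Set X} (h : NullMeasurableSet A μ) :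
    NullMeasurableSet (T.iterImage i A) μ :=
  h.preimage (T.measurePreserving_iterate i).quasiMeasurePreserving

theorem measureReal_iterImage (i : ℕ) {A : Set X} (h : NullMeasurableSet A μ) :
    μ.real (T.iterImage i A) = μ.real A := by
  rw [measureReal_def, measureReal_def, iterImage,
    (T.measurePreserving_iterate i).measure_preimage h]

end Transformation

namespace Construction

variable {T : Transformation μ} (D : Construction T)

/-- The `i`-th level of the stage-`n` tower. -/
def level (n i : ℕ) : Set X := T.iterImage i (D.B n)

theorem nullMeasurableSet_level (n i : ℕ) : NullMeasurableSet (D.level n i) μ :=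
  Transformation.nullMeasurableSet_iterImage i (D.nullMeasurableSet_B n)

theorem measureReal_level (n i : ℕ) : μ.real (D.level n i) = μ.real (D.B n) :=
  Transformation.measureReal_iterImage i (D.nullMeasurableSet_B n)

theorem aedisjoint_level (n : ℕ) {i j : ℕ} (hi : i < D.h n) (hj : j < D.h n) (hij : i ≠ j) :
    AEDisjoint μ (D.level n i) (D.level n j) :=
  D.aedisjoint_levels n i j hi hj hij

/-- The height of the `i`-th copy of the stage-`n` tower in the stage-`(n + 1)` tower. -/
def pos (n i : ℕ) : ℕ := ∑ j ∈ Finset.Ico 1 i, (D.h n + D.s n j)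

theorem pos_succ (n : ℕ) {i : ℕ} (hi : 0 < i) : D.pos n (i + 1) = D.pos n i + (D.h n + D.s n i) := by
  rw [pos, Finset.sum_Ico_succ_top hi, pos]

theorem pos_add_h_le (n : ℕ) {i : ℕ} (hi : 0 < i) (hir : i ≤ D.r n) :
    D.pos n i + D.h n ≤ D.h (n + 1) := by
  -- Copies are numbered from 1, so the position of a fictitious copy `r n + 1` is the full height.
  have h1 : D.h (n + 1) = D.pos n (D.r n + 1) := by
    rw [pos, Finset.sum_add_distrib]
    simp only [Finset.sum_const, Nat.card_Ico, Nat.add_sub_cancel, smul_eq_mul]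
    rfl
  have h2 : D.pos n (i + 1) ≤ D.pos n (D.r n + 1) :=
    Finset.sum_le_sum_of_subset (Finset.Ico_subset_Ico_right (by omega))
  have := D.pos_succ n hi
  omega

theorem h_pos (n : ℕ) : 0 < D.h n := by
  induction n with
  | zero => exact Nat.one_pos
  | succ n ih => exact ih.trans_le (le_trans (Nat.le_add_left _ _)
      (D.pos_add_h_le n Nat.one_pos (D.one_lt_r n).le))

theorem lt_h (n : ℕ) : n < D.h n := by
  induction n with
  | zero => exact D.h_pos 0
  | succ n ih =>
    have h1 := D.pos_add_h_le n Nat.two_pos (D.one_lt_r n)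
    have h2 := D.pos_succ n Nat.one_pos
    have h3 := D.h_pos n
    norm_num at h2
    omega

/-- Climbing from one piece through its `h n` levels and `s n i` spacers leads to the next piece,
starting from `Bsub n 1`, which is the new base. -/
theorem Bsub_ae_eq (n : ℕ) {i : ℕ} (hi : 0 < i) (hir : i ≤ D.r n) :
    D.Bsub n i =ᵐ[μ] D.level (n + 1) (D.pos n i) := by
  induction i, hi using Nat.le_induction with
  | base =>
    have : D.pos n 1 = 0 := by simp [pos]
    rw [this]
    exact (D.base_succ n).symm
  | succ i hi ih =>
    have hir' : i < D.r n := hir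
    have step : D.Bsub n (i + 1) =ᵐ[μ] T.iterImage (D.h n + D.s n i) (D.Bsub n i) := by
      by_cases hs : D.s n i = 0
      · rw [hs]
        exact (D.iterImage_Bsub_of_no_spacer n i hi hir' hs).symm
      · have hC : ∀ j, 1 ≤ j → j ≤ D.s n i →
            D.C n i j =ᵐ[μ] T.iterImage (D.h n + (j - 1)) (D.Bsub n i) := by
          intro j hj
          induction j, hj using Nat.le_induction with
          | base => exact fun _ => (D.iterImage_Bsub_of_spacer n i hi hir'.le hs).symm
          | succ j hj ihj =>
            intro hjs
            have h1 := Transformation.iterImage_ae_eq (T := T) 1 (ihj (by omega))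
            rw [Transformation.iterImage_iterImage] at h1
            have : D.h n + (j - 1) + 1 = D.h n + (j + 1 - 1) := by omega
            rw [this] at h1
            exact (D.image_C n i j hi hir'.le hj hjs).symm.trans h1
        have h1 := Transformation.iterImage_ae_eq (T := T) 1
          (hC (D.s n i) (Nat.pos_of_ne_zero hs) le_rfl)
        rw [Transformation.iterImage_iterImage] at h1
        have : D.h n + (D.s n i - 1) + 1 = D.h n + D.s n i := by omega
        rw [this] at h1
        exact (D.image_last_C n i hi hir' hs).symm.trans h1
    refine step.trans ((Transformation.iterImage_ae_eq _ (ih hir'.le)).trans ?_)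
    rw [level, Transformation.iterImage_iterImage, ← D.pos_succ n hi]
    rfl

theorem measureReal_biUnion_level [IsFiniteMeasure μ] (n : ℕ) {J : Finset ℕ}
    (hJ : J ⊆ Finset.range (D.h n)) :
    μ.real (⋃ i ∈ J, D.level n i) = J.card * μ.real (D.B n) := by
  rw [measureReal_biUnion_finset₀]
  · simp [D.measureReal_level]
  · exact fun i hi j hj hij => D.aedisjoint_level n (Finset.mem_range.1 (hJ hi))
      (Finset.mem_range.1 (hJ hj)) hij
  · exact fun i _ => D.nullMeasurableSet_level n i

theorem B_succ_ae_le (n : ℕ) : D.B (n + 1) ≤ᵐ[μ] D.B n := by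
  refine (D.base_succ n).le.trans (Filter.EventuallyLE.trans ?_ (D.iUnion_Bsub n).le)
  refine (subset_biUnion_of_mem (u := fun i => D.Bsub n i) ?_).eventuallyLE
  exact Finset.mem_coe.2 (Finset.mem_Icc.2 ⟨le_rfl, (D.one_lt_r n).le⟩)

theorem iterImage_biUnion_level (n k : ℕ) (S : Finset ℕ) :
    T.iterImage k (⋃ i ∈ S, D.level n i) = ⋃ i ∈ S, D.level n (i + k) := by
  simp only [Transformation.iterImage, level, preimage_iUnion, Function.iterate_add, preimage_comp]

/-- The bound on `i` records that a whole copy of tower `m` stands over each chosen level. `S` will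
turn out to be `I m n`, but that needs bases of positive measure. -/
theorem exists_B_ae_eq {m n : ℕ} (hmn : m ≤ n) : ∃ S : Finset ℕ,
    (∀ i ∈ S, i + D.h m ≤ D.h n) ∧ D.B m =ᵐ[μ] ⋃ i ∈ S, D.level n i := by
  induction n, hmn using Nat.le_induction with
  | base =>
    refine ⟨{0}, by simp, ?_⟩
    rw [Finset.set_biUnion_singleton]
    exact Filter.EventuallyEq.rfl
  | succ n hmn ih =>
    obtain ⟨S, hS, hB⟩ := ih
    refine ⟨S.biUnion fun i => (Finset.Icc 1 (D.r n)).image fun j => D.pos n j + i, ?_, ?_⟩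
    · intro i hi
      simp only [Finset.mem_biUnion, Finset.mem_image, Finset.mem_Icc] at hi
      obtain ⟨i, hi, j, hj, rfl⟩ := hi
      have := hS i hi
      have := D.pos_add_h_le n hj.1 hj.2
      omega
    · refine hB.trans ?_
      have key : ∀ i, D.level n i =ᵐ[μ]
          ⋃ j ∈ Finset.Icc 1 (D.r n), D.level (n + 1) (D.pos n j + i) := by
        intro i
        have h1 : D.B n =ᵐ[μ] ⋃ j ∈ Finset.Icc 1 (D.r n), D.level (n + 1) (D.pos n j) :=
          (D.iUnion_Bsub n).symm.trans
            (Finset.eventuallyEq_iUnion (Finset.Icc 1 (D.r n)) fun j hj =>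
              D.Bsub_ae_eq n (Finset.mem_Icc.1 hj).1 (Finset.mem_Icc.1 hj).2)
        have h2 := Transformation.iterImage_ae_eq (T := T) i h1
        simp only [Transformation.iterImage, level, preimage_iUnion] at h2
        refine h2.trans (Filter.Eventually.of_forall fun x => ?_)
        simp only [level, Transformation.iterImage, Function.iterate_add, preimage_comp]
      refine (Finset.eventuallyEq_iUnion S fun i _ => key i).trans
        (Filter.EventuallyEq.of_eq (Set.ext fun x => ?_))
      simp only [mem_iUnion, Finset.mem_biUnion, Finset.mem_image, exists_prop]
      constructor
      · rintro ⟨i, hi, j, hj, hx⟩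
        exact ⟨_, ⟨i, hi, j, hj, rfl⟩, hx⟩
      · rintro ⟨_, ⟨i, hi, j, hj, rfl⟩, hx⟩
        exact ⟨i, hi, j, hj, hx⟩

theorem mem_I {m n i : ℕ} : i ∈ D.I m n ↔ i < D.h n ∧ D.level n i ≤ᵐ[μ] D.B m := by
  simp [I, level]

theorem I_subset_range (m n : ℕ) : D.I m n ⊆ Finset.range (D.h n) := by
  classical exact Finset.filter_subset _ _

end Construction
end Basic

/-! ### Positivity of the bases and approximation by levels in a probability space. -/

namespace Construction

variable {X : Type*} [MeasurableSpace X] {μ : Measure X} [IsProbabilityMeasure μ]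
  {T : Transformation μ} (D : Construction T)

/-- One null base makes all bases null: later ones lie inside it, and earlier ones are finite unions
of its translates. Then unions of levels could not approximate the whole space. -/
theorem measureReal_B_pos (n : ℕ) : 0 < μ.real (D.B n) := by
  by_contra hn
  have hn0 : μ (D.B n) = 0 := by
    have := le_antisymm (not_lt.1 hn) measureReal_nonneg
    simpa [measureReal_def, ENNReal.toReal_eq_zero_iff] using this
  have hge : ∀ k, n ≤ k → μ (D.B k) = 0 := by
    intro k hk
    induction k, hk using Nat.le_induction with
    | base => exact hn0
    | succ k _ ih => exact le_antisymm ((measure_mono_ae (D.B_succ_ae_le k)).trans ih.le) zero_le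
  have hall : ∀ k, μ (D.B k) = 0 := by
    intro k
    rcases le_total n k with hk | hk
    · exact hge k hk
    · obtain ⟨S, -, hS⟩ := D.exists_B_ae_eq hk
      rw [measure_congr hS]
      refine (measure_biUnion_null_iff S.countable_toSet).2 fun i _ => ?_
      rw [level, Transformation.iterImage,
        (T.measurePreserving_iterate i).measure_preimage (D.nullMeasurableSet_B n), hn0]
  obtain ⟨k, J, -, hJ⟩ := D.dense_levels univ MeasurableSet.univ 1 one_pos
  have h0 : μ (⋃ i ∈ J, T.iterImage i (D.B k)) = 0 := by
    refine (measure_biUnion_null_iff J.countable_toSet).2 fun i _ => ?_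
    rw [Transformation.iterImage,
      (T.measurePreserving_iterate i).measure_preimage (D.nullMeasurableSet_B k), hall]
  have h1 : (univ : Set X) =ᵐ[μ]
      symmDiff univ (⋃ i ∈ J, T.iterImage i (D.B k)) := by
    have h2 := (Filter.EventuallyEq.refl (ae μ) (univ : Set X)).symmDiff (ae_eq_empty.2 h0)
    rw [← bot_eq_empty, symmDiff_bot] at h2
    exact h2.symm
  have h2 := measure_congr h1
  rw [measure_univ] at h2
  exact hJ.ne h2.symm

theorem B_ae_eq_and_add_h_le {m n : ℕ} (hmn : m ≤ n) :
    (∀ i ∈ D.I m n, i + D.h m ≤ D.h n) ∧ D.B m =ᵐ[μ] ⋃ i ∈ D.I m n, D.level n i := by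
  obtain ⟨S, hS, hB⟩ := D.exists_B_ae_eq hmn
  suffices h : D.I m n = S by rw [h]; exact ⟨hS, hB⟩
  have hlt : ∀ i ∈ S, i < D.h n := fun i hi => by
    have := hS i hi
    have := D.h_pos m
    omega
  ext i
  rw [mem_I]
  constructor
  -- A level outside `S` is disjoint from the union of those in `S`, which is `B m`; lying inside `B
  -- m` it would be null.
  · rintro ⟨hi, hle⟩
    by_contra hiS
    have hd : AEDisjoint μ (D.level n i) (⋃ j ∈ S, D.level n j) := by
      rw [AEDisjoint.iUnion_right_iff]
      intro j
      rw [AEDisjoint.iUnion_right_iff]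
      exact fun hj => D.aedisjoint_level n hi (hlt j hj) (fun h => hiS (h ▸ hj))
    have h0 : μ (D.level n i) = 0 := by
      have h1 : D.level n i ≤ᵐ[μ] (D.level n i ∩ ⋃ j ∈ S, D.level n j : Set X) := by
        filter_upwards [hle.trans hB.le] with x hx hxi
        exact ⟨hxi, hx hxi⟩
      exact le_antisymm ((measure_mono_ae h1).trans hd.le) zero_le
    have h1 := D.measureReal_level n i
    rw [measureReal_def, h0] at h1
    exact (D.measureReal_B_pos n).ne h1
  · intro hi
    refine ⟨hlt i hi, Filter.EventuallyLE.trans ?_ hB.symm.le⟩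
    exact (subset_biUnion_of_mem (u := fun i => D.level n i) (Finset.mem_coe.2 hi)).eventuallyLE

theorem add_h_le_of_mem_I {m n i : ℕ} (hmn : m ≤ n) (hi : i ∈ D.I m n) : i + D.h m ≤ D.h n :=
  (D.B_ae_eq_and_add_h_le hmn).1 i hi

theorem level_ae_eq {m n : ℕ} (hmn : m ≤ n) (k : ℕ) :
    D.level m k =ᵐ[μ] ⋃ i ∈ D.I m n, D.level n (i + k) := by
  have h := Transformation.iterImage_ae_eq (T := T) k (D.B_ae_eq_and_add_h_le hmn).2
  rwa [D.iterImage_biUnion_level] at h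

theorem measureReal_B_eq {m n : ℕ} (hmn : m ≤ n) :
    μ.real (D.B m) = (D.I m n).card * μ.real (D.B n) := by
  rw [measureReal_congr (D.B_ae_eq_and_add_h_le hmn).2,
    D.measureReal_biUnion_level n (D.I_subset_range m n)]

theorem card_I_pos {m n : ℕ} (hmn : m ≤ n) : 0 < (D.I m n).card := by
  by_contra h
  have h1 := D.measureReal_B_eq hmn
  rw [Nat.eq_zero_of_not_pos h, Nat.cast_zero, zero_mul] at h1
  exact (D.measureReal_B_pos m).ne' h1

/-- Measurable sets are approximated by unions of levels of all high enough towers. -/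
theorem exists_forall_approx {A : Set X} (hA : MeasurableSet A) {ε : ℝ} (hε : 0 < ε) :
    ∃ N, ∀ n, N ≤ n → ∃ J ⊆ Finset.range (D.h n),
      μ.real (symmDiff A (⋃ i ∈ J, D.level n i)) < ε := by
  obtain ⟨m, J, hJ, hlt⟩ := D.dense_levels A hA (ENNReal.ofReal ε) (ENNReal.ofReal_pos.2 hε)
  -- An approximant by levels of tower `m` is rewritten as a union of levels of tower `n`, since
  -- level `k` splits into the levels `i + k` with `i ∈ I m n`.
  refine ⟨m, fun n hmn => ⟨J.biUnion fun k => (D.I m n).image fun i => i + k, ?_, ?_⟩⟩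
  · intro j hj
    simp only [Finset.mem_biUnion, Finset.mem_image] at hj
    obtain ⟨k, hk, i, hi, rfl⟩ := hj
    have h1 : k < D.h m := Finset.mem_range.1 (hJ hk)
    have := D.add_h_le_of_mem_I hmn hi
    exact Finset.mem_range.2 (by omega)
  · have heq : (⋃ i ∈ J, D.level m i) =ᵐ[μ]
        ⋃ i ∈ J.biUnion fun k => (D.I m n).image fun i => i + k, D.level n i := by
      refine (Finset.eventuallyEq_iUnion J fun k _ => D.level_ae_eq hmn k).trans
        (Filter.EventuallyEq.of_eq (Set.ext fun x => ?_))
      simp only [mem_iUnion, Finset.mem_biUnion, Finset.mem_image, exists_prop]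
      constructor
      · rintro ⟨i, hi, j, hj, hx⟩
        exact ⟨_, ⟨i, hi, j, hj, rfl⟩, hx⟩
      · rintro ⟨_, ⟨i, hi, j, hj, rfl⟩, hx⟩
        exact ⟨i, hi, j, hj, hx⟩
    rw [← measureReal_congr ((Filter.EventuallyEq.refl _ _).symmDiff heq), measureReal_def]
    exact (ENNReal.toReal_lt_of_lt_ofReal hlt)

/-- The towers fill the space: approximate `univ`, and note that enlarging the approximant to the
whole tower only helps. -/
theorem exists_forall_lt_h_mul {ε : ℝ} (hε : 0 < ε) :
    ∃ N, ∀ n, N ≤ n → 1 - ε < D.h n * μ.real (D.B n) := by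
  obtain ⟨N, hN⟩ := D.exists_forall_approx MeasurableSet.univ hε
  refine ⟨N, fun n hn => ?_⟩
  obtain ⟨J, hJ, hlt⟩ := hN n hn
  have hm : NullMeasurableSet (⋃ i ∈ J, D.level n i) μ :=
    Finset.nullMeasurableSet_biUnion J fun i _ => D.nullMeasurableSet_level n i
  have h1 : symmDiff univ (⋃ i ∈ J, D.level n i) = (⋃ i ∈ J, D.level n i)ᶜ := by
    rw [← top_eq_univ, top_symmDiff]; rfl
  rw [h1, measureReal_compl₀ hm, D.measureReal_biUnion_level n hJ, probReal_univ] at hlt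
  have h2 : (J.card : ℝ) ≤ D.h n := by
    have := Finset.card_le_card hJ
    rw [Finset.card_range] at this
    exact_mod_cast this
  have := mul_le_mul_of_nonneg_right h2 (measureReal_nonneg (μ := μ) (s := D.B n))
  linarith

theorem h_mul_le_one (n : ℕ) : D.h n * μ.real (D.B n) ≤ 1 := by
  have := D.measureReal_biUnion_level n (Finset.Subset.refl (Finset.range (D.h n)))
  rw [Finset.card_range] at this
  rw [← this]
  exact measureReal_le_one

/-- Most levels of a high tower are almost contained in, or almost disjoint from, a given
measurable set. -/
theorem exists_forall_sum_min_lt {A : Set X} (hA : MeasurableSet A) {ε : ℝ} (hε : 0 < ε) :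
    ∃ N, ∀ n, N ≤ n → ∑ i ∈ Finset.range (D.h n),
      min (μ.real (D.level n i ∩ A)) (μ.real (D.level n i ∩ Aᶜ)) < ε := by
  obtain ⟨N, hN⟩ := D.exists_forall_approx hA hε
  refine ⟨N, fun n hn => ?_⟩
  obtain ⟨J, hJ, hlt⟩ := hN n hn
  refine lt_of_le_of_lt ?_ hlt
  set U := ⋃ i ∈ J, D.level n i with hU
  have hUm : NullMeasurableSet U μ :=
    Finset.nullMeasurableSet_biUnion J fun i _ => D.nullMeasurableSet_level n i
  have hSm : NullMeasurableSet (symmDiff A U) μ :=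
    (hA.nullMeasurableSet.diff hUm).union (hUm.diff hA.nullMeasurableSet)
  have hdisj : ∀ i ∈ Finset.range (D.h n), i ∉ J → AEDisjoint μ (D.level n i) U := by
    intro i hi hiJ
    rw [hU, AEDisjoint.iUnion_right_iff]
    intro j
    rw [AEDisjoint.iUnion_right_iff]
    exact fun hj => D.aedisjoint_level n (Finset.mem_range.1 hi) (Finset.mem_range.1 (hJ hj))
      (fun h => hiJ (h ▸ hj))
  -- A level used by the approximant `U` contributes its part outside `A`, any other level its part
  -- inside `A`; both lie in the symmetric difference.
  calc ∑ i ∈ Finset.range (D.h n), min (μ.real (D.level n i ∩ A)) (μ.real (D.level n i ∩ Aᶜ))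
      ≤ ∑ i ∈ Finset.range (D.h n), μ.real (D.level n i ∩ symmDiff A U) := by
        refine Finset.sum_le_sum fun i hi => ?_
        by_cases hiJ : i ∈ J
        · refine (min_le_right _ _).trans (measureReal_mono ?_)
          rintro x ⟨hx, hxA⟩
          exact ⟨hx, Or.inr ⟨mem_biUnion (Finset.mem_coe.2 hiJ) hx, hxA⟩⟩
        · refine (min_le_left _ _).trans ?_
          refine ENNReal.toReal_mono (measure_ne_top _ _) (measure_mono_ae ?_)
          filter_upwards [measure_eq_zero_iff_ae_notMem.1 (hdisj i hi hiJ)] with x hx hxA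
          exact ⟨hxA.1, Or.inl ⟨hxA.2, fun h => hx ⟨hxA.1, h⟩⟩⟩
    _ = μ.real (⋃ i ∈ Finset.range (D.h n), (D.level n i ∩ symmDiff A U)) := by
        rw [measureReal_biUnion_finset₀]
        · exact fun i hi j hj hij => (D.aedisjoint_level n (Finset.mem_range.1 hi)
            (Finset.mem_range.1 hj) hij).mono inter_subset_left inter_subset_left
        · exact fun i _ => (D.nullMeasurableSet_level n i).inter hSm
    _ ≤ μ.real (symmDiff A U) :=
        measureReal_mono (iUnion₂_subset fun i _ => inter_subset_right)

end Construction
-- Equivariant maps to `ℤ/k` and their values on levels.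
/-- `φ` intertwines `T` with the translation by `1` of `ℤ / kℤ`. -/
structure IsEquivariant {X : Type*} [MeasurableSpace X] {μ : Measure X} (T : Transformation μ)
    {k : ℕ} (φ : X → ZMod k) : Prop where
  measurable : Measurable φ
  apply_toFun : ∀ᵐ x ∂μ, φ (T.toFun x) = φ x + 1

section

variable {X : Type*} [MeasurableSpace X] {μ : Measure X} {T : Transformation μ}

theorem IsEquivariant.apply_iterate {k : ℕ} {φ : X → ZMod k} (h : IsEquivariant T φ) (i : ℕ) :
    ∀ᵐ x ∂μ, φ (T.invFun^[i] x) = φ x - i := by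
  induction i with
  | zero => simp
  | succ i ih =>
    filter_upwards [T.measurePreserving_invFun.quasiMeasurePreserving.ae ih,
      T.measurePreserving_invFun.quasiMeasurePreserving.ae h.apply_toFun, T.right_inv]
      with x h1 h2 h3
    rw [h3] at h2
    rw [Function.iterate_succ_apply, h1, h2]
    push_cast
    ring

theorem Construction.measureReal_level_inter (D : Construction T) (n i : ℕ) {A A' : Set X}
    (hA' : MeasurableSet A') (h : T.iterImage i A' =ᵐ[μ] A) :
    μ.real (D.level n i ∩ A) = μ.real (D.B n ∩ A') := by
  rw [← Transformation.measureReal_iterImage (T := T) i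
    ((D.nullMeasurableSet_B n).inter hA'.nullMeasurableSet)]
  exact measureReal_congr ((Filter.EventuallyEq.refl _ _).inter h.symm)

theorem IsEquivariant.measurableSet {k : ℕ} {φ : X → ZMod k} (h : IsEquivariant T φ)
    (s : Set (ZMod k)) : MeasurableSet (φ ⁻¹' s) :=
  h.measurable trivial

theorem IsEquivariant.measureReal_level_inter {k : ℕ} {φ : X → ZMod k} (h : IsEquivariant T φ)
    (D : Construction T) (n i : ℕ) (a : ZMod k) :
    μ.real (D.level n i ∩ φ ⁻¹' {a + i}) = μ.real (D.B n ∩ φ ⁻¹' {a}) := by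
  refine D.measureReal_level_inter n i (h.measurableSet _) (Filter.eventuallyEq_set.2 ?_)
  filter_upwards [h.apply_iterate i] with x hx
  simp only [Transformation.iterImage, mem_preimage, mem_singleton_iff, hx, sub_eq_iff_eq_add]

/-- Each residue occurs at least `⌊h / k⌋` times, and `⌊h / k⌋ ≥ h / (2k)` once `h ≥ k`. -/
theorem card_filter_natCast_eq_le (k h : ℕ) [NeZero k] (hk : k ≤ h) (a : ZMod k) :
    (h : ℝ) ≤ 2 * k * ((Finset.range h).filter fun i : ℕ => (i : ZMod k) = a).card := by
  have hk0 : 0 < k := Nat.pos_of_ne_zero (NeZero.ne k)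
  have h1 : h / k ≤ ((Finset.range h).filter fun i : ℕ => (i : ZMod k) = a).card := by
    rw [← Finset.card_range (h / k)]
    refine Finset.card_le_card_of_injOn (fun q => a.val + k * q) ?_ ?_
    · intro q hq
      have hq' : q < h / k := by simpa using hq
      have h2 := ZMod.val_lt a
      have h3 : k * (q + 1) ≤ h := (Nat.mul_le_mul_left k hq').trans (Nat.mul_div_le h k)
      simp only [Finset.coe_filter, Finset.mem_range, mem_ofPred_eq]
      refine ⟨by rw [Nat.mul_add] at h3; omega, by simp⟩
    · intro p _ q _ hpq
      exact Nat.eq_of_mul_eq_mul_left hk0 (by simpa using hpq)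
  have h2 : 1 ≤ h / k := (Nat.one_le_div_iff hk0).2 hk
  have h3 : h < k * (h / k) + k := Nat.lt_mul_div_succ h hk0
  have h4 : k ≤ k * (h / k) := Nat.le_mul_of_pos_right k h2
  have h5 := Nat.mul_le_mul_left k h1
  have h6 : h ≤ 2 * k * ((Finset.range h).filter fun i : ℕ => (i : ZMod k) = a).card := by
    rw [mul_assoc]; omega
  exact_mod_cast h6

end

/-! ### Ergodicity, and concentration of equivariant maps on the bases. -/

section

variable {X : Type*} [MeasurableSpace X] {μ : Measure X} [IsProbabilityMeasure μ]
  {T : Transformation μ}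

/-- An invariant set occupies the same proportion of every level, so approximation by levels forces
this proportion close to 0 or 1, while the tower fills almost all of the space. -/
theorem Construction.ergodic (D : Construction T) : Ergodic T.toFun μ := by
  refine ⟨T.measurePreserving_toFun, ⟨fun A hA hTA => ?_⟩⟩
  rw [Filter.eventuallyConst_set']
  by_contra hcon
  rw [not_or] at hcon
  have hA0 : 0 < μ.real A := by
    refine lt_of_le_of_ne measureReal_nonneg fun h => hcon.1 (ae_eq_empty.2 ?_)
    simpa [measureReal_def, ENNReal.toReal_eq_zero_iff] using h.symm
  have hA1 : 0 < μ.real Aᶜ := by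
    refine lt_of_le_of_ne measureReal_nonneg fun h => hcon.2 (ae_eq_univ.2 ?_)
    simpa [measureReal_def, ENNReal.toReal_eq_zero_iff] using h.symm
  have hinv : ∀ i, T.iterImage i A =ᵐ[μ] A := by
    have h1 : T.iterImage 1 A =ᵐ[μ] A := by
      refine Filter.eventuallyEq_set.2 ?_
      filter_upwards [T.right_inv] with x hx
      change T.invFun x ∈ A ↔ x ∈ A
      rw [← hTA, mem_preimage, hx, hTA]
    intro i
    induction i with
    | zero => exact Filter.EventuallyEq.rfl
    | succ i ih =>
      rw [add_comm, ← Transformation.iterImage_iterImage]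
      exact (Transformation.iterImage_ae_eq i h1).trans ih
  have hsum : ∀ n, ∀ s : Set X, MeasurableSet s → (∀ i, T.iterImage i s =ᵐ[μ] s) →
      D.h n * μ.real (D.B n ∩ s) ≤ μ.real s := by
    intro n s hs hsi
    calc D.h n * μ.real (D.B n ∩ s) = ∑ i ∈ Finset.range (D.h n), μ.real (D.level n i ∩ s) := by
          simp [D.measureReal_level_inter n _ hs (hsi _)]
      _ = μ.real (⋃ i ∈ Finset.range (D.h n), (D.level n i ∩ s)) := by
          rw [measureReal_biUnion_finset₀]
          · exact fun i hi j hj hij => (D.aedisjoint_level n (Finset.mem_range.1 hi)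
              (Finset.mem_range.1 hj) hij).mono inter_subset_left inter_subset_left
          · exact fun i _ => (D.nullMeasurableSet_level n i).inter hs.nullMeasurableSet
      _ ≤ μ.real s := measureReal_mono (iUnion₂_subset fun i _ => inter_subset_right)
  have hinvc : ∀ i, T.iterImage i Aᶜ =ᵐ[μ] (Aᶜ : Set X) := fun i => (hinv i).compl
  obtain ⟨ε, hε, hε0, hε1⟩ : ∃ ε : ℝ, 0 < ε ∧ 2 * ε ≤ μ.real A ∧ 2 * ε ≤ μ.real Aᶜ :=
    ⟨min (μ.real A) (μ.real Aᶜ) / 2, by positivity,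
      by linarith [min_le_left (μ.real A) (μ.real Aᶜ)],
      by linarith [min_le_right (μ.real A) (μ.real Aᶜ)]⟩
  obtain ⟨N, hN⟩ := D.exists_forall_sum_min_lt hA hε
  obtain ⟨N', hN'⟩ := D.exists_forall_lt_h_mul hε
  have h1 := hN (max N N') (le_max_left _ _)
  have h2 := hN' (max N N') (le_max_right _ _)
  set n := max N N'
  simp only [D.measureReal_level_inter n _ hA (hinv _),
    D.measureReal_level_inter n _ hA.compl (hinvc _), Finset.sum_const, Finset.card_range,
    nsmul_eq_mul] at h1
  have h3 := hsum n A hA hinv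
  have h4 := hsum n Aᶜ hA.compl hinvc
  have h5 : μ.real (D.B n ∩ A) + μ.real (D.B n ∩ Aᶜ) = μ.real (D.B n) := by
    rw [← sdiff_eq]
    exact measureReal_inter_add_sdiff hA
  have h6 : μ.real A + μ.real Aᶜ = 1 := probReal_add_probReal_compl hA
  rw [← h5, mul_add] at h2
  -- If the smaller part is `A`, the tower has measure below `ε + μ Aᶜ ≤ 1 - ε`, against `h2`; the
  -- other case is symmetric.
  rcases min_choice (μ.real (D.B n ∩ A)) (μ.real (D.B n ∩ Aᶜ)) with h | h <;> rw [h] at h1 <;>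
    linarith

theorem IsEquivariant.exists_concentrated {k : ℕ} [NeZero k] {φ : X → ZMod k}
    (h : IsEquivariant T φ) (D : Construction T) {δ : ℝ} (hδ : 0 < δ) :
    ∃ N, ∀ n, N ≤ n → ∃ c : ZMod k,
      μ.real (D.B n) - μ.real (D.B n ∩ φ ⁻¹' {c}) < δ * μ.real (D.B n) := by
  have hk0 : (0 : ℝ) < k := Nat.cast_pos.2 (Nat.pos_of_ne_zero (NeZero.ne k))
  -- The factor `4k` is `2k` from counting a residue class of levels, times 2 from `h_n b_n > 1/2`.
  -- The bound by `1/k` serves the pigeonhole at the end.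
  obtain ⟨ε, hε, hε1, hε2⟩ : ∃ ε : ℝ, 0 < ε ∧ 4 * k * ε ≤ δ ∧ 4 * k * ε ≤ (k : ℝ)⁻¹ := by
    refine ⟨min δ (k : ℝ)⁻¹ / (4 * k), by positivity, ?_, ?_⟩ <;> rw [mul_div_cancel₀ _ (by positivity)]
    · exact min_le_left _ _
    · exact min_le_right _ _
  obtain ⟨N, hN⟩ := D.exists_forall_sum_min_lt (h.measurableSet {0}) hε
  obtain ⟨N', hN'⟩ := D.exists_forall_lt_h_mul (ε := 1 / 2) (by norm_num)
  refine ⟨max (max N N') k, fun n hn => ?_⟩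
  have h1 := hN n (by omega)
  have h2 := hN' n (by omega)
  have hkh : k ≤ D.h n := by
    have := D.lt_h n
    omega
  set b := μ.real (D.B n) with hb
  set f : ZMod k → ℝ := fun a => μ.real (D.B n ∩ φ ⁻¹' {a}) with hf
  have hb0 : 0 < b := D.measureReal_B_pos n
  have hlev : ∀ i : ℕ, μ.real (D.level n i ∩ φ ⁻¹' {0}) = f (-i) := by
    intro i
    have h3 := h.measureReal_level_inter D n i (-i)
    rwa [neg_add_cancel] at h3
  have hlevc : ∀ i : ℕ, μ.real (D.level n i ∩ (φ ⁻¹' {0})ᶜ) = b - f (-i) := by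
    intro i
    rw [← hlev i, hb, ← D.measureReal_level n i, ← sdiff_eq,
      ← measureReal_inter_add_sdiff (s := D.level n i) (h.measurableSet {0})]
    ring
  simp only [hlev, hlevc] at h1
  have hfb : ∀ a, f a ≤ b := fun a => measureReal_mono inter_subset_left
  have hg0 : ∀ a, 0 ≤ min (f a) (b - f a) := fun a =>
    le_min measureReal_nonneg (sub_nonneg.2 (hfb a))
  have hsum : ∑ a, f a = b := by
    rw [hb, ← measureReal_biUnion_finset₀]
    · congr 1
      ext x
      simp
    · intro a _ a' _ haa'
      refine Disjoint.aedisjoint (Set.disjoint_left.2 ?_)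
      rintro x ⟨-, hx⟩ ⟨-, hx'⟩
      exact haa' (hx.symm.trans hx')
    · exact fun a _ => (D.nullMeasurableSet_B n).inter (h.measurableSet _).nullMeasurableSet
  -- All levels of index `i ≡ -a` contribute the same term, and they make up at least a fraction
  -- `1/(2k)` of the tower.
  have hg : ∀ a, min (f a) (b - f a) < 4 * k * ε * b := by
    intro a
    have h3 := card_filter_natCast_eq_le k (D.h n) hkh (-a)
    set S := (Finset.range (D.h n)).filter fun i : ℕ => (i : ZMod k) = -a with hS
    have h4 : S.card * min (f a) (b - f a) < ε := by
      refine lt_of_le_of_lt ?_ h1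
      calc S.card * min (f a) (b - f a) = ∑ i ∈ S, min (f (-i)) (b - f (-i)) := by
            rw [Finset.sum_congr rfl (g := fun _ => min (f a) (b - f a)), Finset.sum_const,
              nsmul_eq_mul]
            intro i hi
            rw [(Finset.mem_filter.1 hi).2, neg_neg]
        _ ≤ _ := Finset.sum_le_sum_of_subset_of_nonneg (Finset.filter_subset _ _)
            fun i _ _ => hg0 _
    have h5 : D.h n * min (f a) (b - f a) ≤ 2 * k * ε := by
      calc D.h n * min (f a) (b - f a) ≤ 2 * k * S.card * min (f a) (b - f a) :=
            mul_le_mul_of_nonneg_right h3 (hg0 a)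
        _ = 2 * k * (S.card * min (f a) (b - f a)) := by ring
        _ ≤ 2 * k * ε := by gcongr
    have h6 : D.h n * min (f a) (b - f a) < D.h n * (4 * k * ε * b) := by
      have h7 : 0 < 4 * k * ε := by positivity
      nlinarith
    exact lt_of_mul_lt_mul_left h6 (Nat.cast_nonneg _)
  obtain ⟨c, -, hc⟩ : ∃ c ∈ Finset.univ, b / k ≤ f c := by
    refine Finset.exists_le_of_sum_le Finset.univ_nonempty ?_
    rw [hsum, Finset.sum_const, Finset.card_univ, ZMod.card, nsmul_eq_mul,
      mul_div_cancel₀ _ hk0.ne']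
  refine ⟨c, ?_⟩
  have h3 := hg c
  -- The minimum cannot be `f c`, which is at least `b / k`; so the complement of the fibre over `c`
  -- is small in the base.
  rcases min_choice (f c) (b - f c) with h4 | h4 <;> rw [h4] at h3
  · have h5 := mul_le_mul_of_nonneg_right hε2 hb0.le
    rw [← div_eq_inv_mul] at h5
    linarith
  · exact h3.trans_le (mul_le_mul_of_nonneg_right hε1 hb0.le)

/-- On a level with index `i ≢ c - c'`, the points with `φ = c' + i` belong to the exceptional part
of `B m` and fill at least half of the level. The exceptional part has measure below `δ b_m = δ |I m
n| b_n`, which bounds the number of such levels. -/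
theorem IsEquivariant.card_filter_lt {k : ℕ} {φ : X → ZMod k} (h : IsEquivariant T φ)
    (D : Construction T) {m n : ℕ} (hmn : m ≤ n) {δ : ℝ} (hδ : δ ≤ 1 / 2) {c c' : ZMod k}
    (hc : μ.real (D.B m) - μ.real (D.B m ∩ φ ⁻¹' {c}) < δ * μ.real (D.B m))
    (hc' : μ.real (D.B n) - μ.real (D.B n ∩ φ ⁻¹' {c'}) < δ * μ.real (D.B n)) :
    (((D.I m n).filter fun i : ℕ => (i : ZMod k) ≠ c - c').card : ℝ) < 2 * δ * (D.I m n).card := by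
  set S := (D.I m n).filter fun i : ℕ => (i : ZMod k) ≠ c - c' with hS
  have hlt : ∀ i ∈ S, i < D.h n := fun i hi =>
    Finset.mem_range.1 (D.I_subset_range m n (Finset.filter_subset _ _ hi))
  have h1 : S.card * μ.real (D.B n ∩ φ ⁻¹' {c'}) ≤
      μ.real (D.B m) - μ.real (D.B m ∩ φ ⁻¹' {c}) := by
    calc S.card * μ.real (D.B n ∩ φ ⁻¹' {c'})
        = ∑ i ∈ S, μ.real (D.level n i ∩ φ ⁻¹' {c' + i}) := by
          simp [h.measureReal_level_inter]
      _ = μ.real (⋃ i ∈ S, (D.level n i ∩ φ ⁻¹' {c' + (i : ZMod k)})) := by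
          rw [measureReal_biUnion_finset₀]
          · exact fun i hi j hj hij => (D.aedisjoint_level n (hlt i hi) (hlt j hj) hij).mono
              inter_subset_left inter_subset_left
          · exact fun i _ => (D.nullMeasurableSet_level n i).inter
              (h.measurableSet _).nullMeasurableSet
      _ ≤ μ.real (D.B m \ φ ⁻¹' {c}) := by
          refine ENNReal.toReal_mono (measure_ne_top _ _) (measure_mono_ae ?_)
          filter_upwards [(D.B_ae_eq_and_add_h_le hmn).2.symm.le] with x hx hxS
          obtain ⟨i, hi, hxi, hφ⟩ := mem_iUnion₂.1 hxS
          have hi' := Finset.mem_filter.1 hi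
          refine ⟨hx (mem_iUnion₂.2 ⟨i, hi'.1, hxi⟩), fun hxc => hi'.2 ?_⟩
          rw [eq_sub_iff_add_eq, add_comm]
          exact (mem_singleton_iff.1 hφ).symm.trans hxc
      _ = _ := by
          rw [← measureReal_inter_add_sdiff (s := D.B m) (h.measurableSet {c})]
          ring
  have h2 := D.measureReal_B_eq hmn
  rw [h2] at hc
  have hb := D.measureReal_B_pos n
  have h3 : S.card * (1 / 2 * μ.real (D.B n)) ≤ S.card * μ.real (D.B n ∩ φ ⁻¹' {c'}) := by
    have := mul_le_mul_of_nonneg_right hδ hb.le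
    exact mul_le_mul_of_nonneg_left (by linarith) (Nat.cast_nonneg _)
  rw [h2] at h1
  have h4 : (S.card : ℝ) * μ.real (D.B n) < 2 * δ * (D.I m n).card * μ.real (D.B n) := by
    linarith
  exact lt_of_mul_lt_mul_right h4 hb.le

theorem IsEquivariant.exists_card_filter_div_lt {k : ℕ} [NeZero k] {φ : X → ZMod k}
    (h : IsEquivariant T φ) (D : Construction T) {η : ℝ} (hη : 0 < η) :
    ∃ N : ℕ, ∀ m n : ℕ, N ≤ m → m ≤ n → ∃ j : ZMod k,
      (((D.I m n).filter fun i : ℕ => (i : ZMod k) ≠ j).card : ℝ) / ((D.I m n).card : ℝ) < η := by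
  have hδ : 0 < min (η / 2) (1 / 2) := by positivity
  obtain ⟨N, hN⟩ := h.exists_concentrated D hδ
  refine ⟨N, fun m n hm hmn => ?_⟩
  obtain ⟨c, hc⟩ := hN m hm
  obtain ⟨c', hc'⟩ := hN n (hm.trans hmn)
  refine ⟨c - c', ?_⟩
  have h1 : (0 : ℝ) < (D.I m n).card := Nat.cast_pos.2 (D.card_I_pos hmn)
  rw [div_lt_iff₀ h1]
  refine (h.card_filter_lt D hmn (min_le_right _ _) hc hc').trans_le ?_
  have := min_le_left (η / 2) (1 / 2 : ℝ)
  exact mul_le_mul_of_nonneg_right (by linarith) h1.le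

end

/-! ### From the arithmetic condition to an equivariant map. -/

open Filter Topology

namespace Construction

variable {X : Type*} [MeasurableSpace X] {μ : Measure X} {T : Transformation μ} (D : Construction T)

/-- The map that sends the points of the `i`-th level of the stage-`n` tower to `i` modulo `k`. -/
noncomputable def indexMod (k n : ℕ) (x : X) : ZMod k :=
  ∑ i ∈ Finset.range (D.h n), (D.level n i).indicator (fun _ => (i : ZMod k)) x

theorem aemeasurable_indexMod (k : ℕ) [NeZero k] (n : ℕ) : AEMeasurable (D.indexMod k n) μ :=
  Finset.aemeasurable_fun_sum _ fun i _ =>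
    aemeasurable_const.indicator₀ (D.nullMeasurableSet_level n i)

theorem indexMod_ae_eq (k n : ℕ) :
    ∀ᵐ x ∂μ, ∀ i, i < D.h n → x ∈ D.level n i → D.indexMod k n x = i := by
  have h1 : ∀ᵐ x ∂μ, ∀ i j, i < D.h n → j < D.h n → i ≠ j →
      x ∉ D.level n i ∩ D.level n j := by
    simp only [ae_all_iff]
    exact fun i j hi hj hij => measure_eq_zero_iff_ae_notMem.1 (D.aedisjoint_level n hi hj hij)
  filter_upwards [h1] with x hx i hi hxi
  rw [indexMod, Finset.sum_eq_single i, indicator_of_mem hxi]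
  · intro j hj hji
    exact indicator_of_notMem (fun hxj => hx j i (Finset.mem_range.1 hj) hi hji ⟨hxj, hxi⟩) _
  · exact fun h => absurd (Finset.mem_range.2 hi) h

end Construction

section

variable {X : Type*} [MeasurableSpace X] {μ : Measure X} [IsProbabilityMeasure μ]
  {T : Transformation μ}

/-- A sequence of maps to `ℤ / kℤ` that are asymptotically equivariant, and asymptotically equal
to each other up to translations, yields an equivariant map. -/
theorem exists_isEquivariant {k : ℕ} {ψ : ℕ → X → ZMod k} (hψ : ∀ n, AEMeasurable (ψ n) μ)
    (h1 : ∀ ε : ℝ, 0 < ε → ∃ N, ∀ m n, N ≤ m → m ≤ n →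
      ∃ j, μ.real {x | ψ n x ≠ ψ m x + j} ≤ ε)
    (h2 : ∀ ε : ℝ, 0 < ε → ∃ N, ∀ n, N ≤ n → μ.real {x | ψ n (T.toFun x) ≠ ψ n x + 1} ≤ ε) :
    ∃ φ : X → ZMod k, IsEquivariant T φ := by
  obtain ⟨ε, hε, hεsum⟩ := ENNReal.exists_pos_sum_of_countable one_ne_zero ℕ
  choose N₁ hN₁ using fun l => h1 (ε l) (hε l)
  choose N₂ hN₂ using fun l => h2 (ε l) (hε l)
  -- Partial sums give a monotone sequence dominating both thresholds.
  set M : ℕ → ℕ := fun l => ∑ i ∈ Finset.range (l + 1), (N₁ i + N₂ i) with hM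
  have hM₁ : ∀ l, N₁ l + N₂ l ≤ M l := fun l =>
    Finset.single_le_sum (f := fun i => N₁ i + N₂ i) (fun _ _ => Nat.zero_le _)
      (Finset.self_mem_range_succ l)
  have hMmono : ∀ l, M l ≤ M (l + 1) := fun l => by
    simp only [hM, Finset.sum_range_succ _ (l + 1), le_add_iff_nonneg_right, zero_le]
  choose j hj using fun l => hN₁ l (M l) (M (l + 1)) (by have := hM₁ l; omega) (hMmono l)
  -- Subtracting the accumulated translations makes consecutive maps agree off sets of summable
  -- measure, so by Borel–Cantelli the sequence is eventually constant at almost every point.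
  set θ : ℕ → X → ZMod k := fun l x => ψ (M l) x - ∑ i ∈ Finset.range l, j i with hθ
  have summable : ∀ s : ℕ → Set X, (∀ l, μ.real (s l) ≤ ε l) → ∑' l, μ (s l) ≠ ∞ := by
    intro s hs
    refine ne_top_of_le_ne_top (hεsum.trans ENNReal.one_lt_top).ne (ENNReal.tsum_le_tsum fun l => ?_)
    have := ENNReal.ofReal_le_ofReal (hs l)
    rwa [ofReal_measureReal, ENNReal.ofReal_coe_nnreal] at this
  have hA : ∀ᵐ x ∂μ, ∀ᶠ l in atTop, θ (l + 1) x = θ l x := by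
    filter_upwards [ae_eventually_notMem (summable _ hj)] with x hx
    filter_upwards [hx] with l hl
    have hl' : ψ (M (l + 1)) x = ψ (M l) x + j l := not_not.1 hl
    simp only [hθ, hl', Finset.sum_range_succ]
    ring
  have hB : ∀ᵐ x ∂μ, ∀ᶠ l in atTop, θ l (T.toFun x) = θ l x + 1 := by
    filter_upwards [ae_eventually_notMem (summable _ fun l =>
      hN₂ l (M l) (by have := hM₁ l; omega))] with x hx
    filter_upwards [hx] with l hl
    have hl' : ψ (M l) (T.toFun x) = ψ (M l) x + 1 := not_not.1 hl
    simp only [hθ, hl']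
    ring
  have hlim : ∀ᵐ x ∂μ, ∃ c, Tendsto (fun l => θ l x) atTop (𝓝 c) := by
    filter_upwards [hA] with x hx
    obtain ⟨L, hL⟩ := eventually_atTop.1 hx
    refine ⟨θ L x, tendsto_nhds_of_eventually_eq ?_⟩
    filter_upwards [eventually_ge_atTop L] with l hl
    induction l, hl using Nat.le_induction with
    | base => rfl
    | succ l hl ih => rw [hL l hl, ih]
  have hθm : ∀ l, AEMeasurable (θ l) μ := fun l =>
    (Measurable.of_discrete (f := fun a : ZMod k => a - ∑ i ∈ Finset.range l, j i)).comp_aemeasurable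
      (hψ (M l))
  obtain ⟨φ, hφ, hφlim⟩ := measurable_limit_of_tendsto_metrizable_ae hθm hlim
  refine ⟨φ, hφ, ?_⟩
  filter_upwards [hφlim, T.measurePreserving_toFun.quasiMeasurePreserving.ae hφlim, hB]
    with x h3 h4 h5
  have h6 : Tendsto (fun l => θ l x + 1) atTop (𝓝 (φ x + 1)) :=
    (continuous_of_discreteTopology (f := fun a : ZMod k => a + 1)).continuousAt.tendsto.comp h3
  exact tendsto_nhds_unique (h4.congr' h5) h6

namespace Construction

variable (D : Construction T)

theorem measureReal_compl_biUnion_level (n : ℕ) {J : Finset ℕ}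
    (hJ : J ⊆ Finset.range (D.h n)) :
    μ.real (⋃ i ∈ J, D.level n i)ᶜ = 1 - J.card * μ.real (D.B n) := by
  rw [measureReal_compl₀ (Finset.nullMeasurableSet_biUnion J fun i _ => D.nullMeasurableSet_level n i),
    probReal_univ, D.measureReal_biUnion_level n hJ]

/-- Equivariance can fail only outside the tower or on its top level, where the next height is not
controlled. -/
theorem measureReal_indexMod_toFun_ne_le (k n : ℕ) :
    μ.real {x | D.indexMod k n (T.toFun x) ≠ D.indexMod k n x + 1} ≤
      1 - D.h n * μ.real (D.B n) + μ.real (D.B n) := by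
  have h0 := D.h_pos n
  have h1 := D.measureReal_compl_biUnion_level n (J := Finset.range (D.h n - 1))
    (Finset.range_subset_range.2 (Nat.sub_le _ _))
  rw [Finset.card_range, Nat.cast_sub h0] at h1
  have h2 : μ.real {x | D.indexMod k n (T.toFun x) ≠ D.indexMod k n x + 1} ≤
      μ.real (⋃ i ∈ Finset.range (D.h n - 1), D.level n i)ᶜ := by
    refine ENNReal.toReal_mono (measure_ne_top _ _) (measure_mono_ae ?_)
    filter_upwards [D.indexMod_ae_eq k n, T.left_inv,
      T.measurePreserving_toFun.quasiMeasurePreserving.ae (D.indexMod_ae_eq k n)]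
      with x hx hinv hTx hne hmem
    obtain ⟨i, hi, hxi⟩ := mem_iUnion₂.1 hmem
    have hi' : i + 1 < D.h n := by
      have := Finset.mem_range.1 hi
      omega
    refine hne ?_
    rw [hx i (by omega) hxi, hTx (i + 1) hi' ?_, Nat.cast_add, Nat.cast_one]
    rw [level, Transformation.iterImage, mem_preimage, Function.iterate_succ_apply, hinv]
    exact hxi
  refine h2.trans (h1.trans ?_).le
  push_cast
  ring

/-- At height `l` in the copy of tower `m` that starts at level `i` of tower `n`, the two indices
differ by exactly `i`. The bad points thus lie outside tower `m` or in copies with `i ≢ j`; each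
copy has measure `h_m b_n ≤ 1 / |I m n|`. -/
theorem measureReal_indexMod_ne_le (k : ℕ) {m n : ℕ} (hmn : m ≤ n) (j : ZMod k) :
    μ.real {x | D.indexMod k n x ≠ D.indexMod k m x + j} ≤
      1 - D.h m * μ.real (D.B m) +
        ((D.I m n).filter fun i : ℕ => (i : ZMod k) ≠ j).card / (D.I m n).card := by
  set S := (D.I m n).filter fun i : ℕ => (i : ZMod k) ≠ j with hS
  have h1 := D.measureReal_compl_biUnion_level m (Finset.Subset.refl (Finset.range (D.h m)))
  rw [Finset.card_range] at h1
  have h2 : μ.real {x | D.indexMod k n x ≠ D.indexMod k m x + j} ≤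
      μ.real ((⋃ l ∈ Finset.range (D.h m), D.level m l)ᶜ ∪
        ⋃ l ∈ Finset.range (D.h m), ⋃ i ∈ S, D.level n (i + l)) := by
    refine ENNReal.toReal_mono (measure_ne_top _ _) (measure_mono_ae ?_)
    have hlev : ∀ᵐ x ∂μ, ∀ l, x ∈ D.level m l → x ∈ ⋃ i ∈ D.I m n, D.level n (i + l) :=
      ae_all_iff.2 fun l => (D.level_ae_eq hmn l).le
    filter_upwards [D.indexMod_ae_eq k n, D.indexMod_ae_eq k m, hlev] with x hn hm hl hne
    by_cases hx : x ∈ ⋃ l ∈ Finset.range (D.h m), D.level m l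
    · right
      obtain ⟨l, hlr, hxl⟩ := mem_iUnion₂.1 hx
      obtain ⟨i, hi, hxi⟩ := mem_iUnion₂.1 (hl l hxl)
      have hlr' := Finset.mem_range.1 hlr
      have hil := D.add_h_le_of_mem_I hmn hi
      refine mem_iUnion₂.2 ⟨l, hlr, mem_iUnion₂.2 ⟨i, Finset.mem_filter.2 ⟨hi, fun hij => hne ?_⟩, hxi⟩⟩
      rw [hn (i + l) (by omega) hxi, hm l hlr' hxl, Nat.cast_add, hij, add_comm]
    · exact Or.inl hx
  have h3 : μ.real (⋃ l ∈ Finset.range (D.h m), ⋃ i ∈ S, D.level n (i + l)) ≤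
      S.card / (D.I m n).card := by
    calc _ ≤ ∑ l ∈ Finset.range (D.h m), μ.real (⋃ i ∈ S, D.level n (i + l)) :=
          measureReal_biUnion_finset_le _ _
      _ ≤ ∑ l ∈ Finset.range (D.h m), ∑ i ∈ S, μ.real (D.level n (i + l)) :=
          Finset.sum_le_sum fun l _ => measureReal_biUnion_finset_le _ _
      _ = S.card * (D.h m * μ.real (D.B n)) := by
          simp only [D.measureReal_level, Finset.sum_const, Finset.card_range, nsmul_eq_mul]
          ring
      _ ≤ _ := by
          have h4 : (0 : ℝ) < (D.I m n).card := Nat.cast_pos.2 (D.card_I_pos hmn)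
          rw [le_div_iff₀ h4, mul_assoc]
          refine mul_le_of_le_one_right (Nat.cast_nonneg _) ?_
          have h5 := D.h_mul_le_one m
          rw [D.measureReal_B_eq hmn] at h5
          linarith
  linarith [measureReal_union_le (μ := μ) (⋃ l ∈ Finset.range (D.h m), D.level m l)ᶜ
    (⋃ l ∈ Finset.range (D.h m), ⋃ i ∈ S, D.level n (i + l))]

theorem exists_isEquivariant {k : ℕ} [NeZero k]
    (h : ∀ η : ℝ, 0 < η → ∃ N : ℕ, ∀ m n : ℕ, N ≤ m → m ≤ n → ∃ j : ZMod k,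
      (((D.I m n).filter fun i : ℕ => (i : ZMod k) ≠ j).card : ℝ) / ((D.I m n).card : ℝ) < η) :
    ∃ φ : X → ZMod k, IsEquivariant T φ := by
  refine RankOne.exists_isEquivariant (D.aemeasurable_indexMod k) (fun ε hε => ?_) fun ε hε => ?_
  · obtain ⟨N, hN⟩ := h (ε / 2) (half_pos hε)
    obtain ⟨N', hN'⟩ := D.exists_forall_lt_h_mul (half_pos hε)
    refine ⟨max N N', fun m n hm hmn => ?_⟩
    obtain ⟨j, hj⟩ := hN m n (by omega) hmn
    refine ⟨j, (D.measureReal_indexMod_ne_le k hmn j).trans ?_⟩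
    linarith [hN' m (by omega)]
  · obtain ⟨N, hN⟩ := D.exists_forall_lt_h_mul (half_pos hε)
    -- Since `h_n b_n ≤ 1`, a height above `2 / ε` forces `b_n ≤ ε / 2`, which takes care of the top
    -- level.
    obtain ⟨N', hN'⟩ := exists_nat_gt (2 / ε)
    refine ⟨max N N', fun n hn => (D.measureReal_indexMod_toFun_ne_le k n).trans ?_⟩
    have h1 := hN n (by omega)
    have h2 := D.h_mul_le_one n
    have h3 : 2 / ε < D.h n := hN'.trans (by
      have := D.lt_h n
      exact_mod_cast (by omega : N' < D.h n))
    have h4 : μ.real (D.B n) ≤ ε / 2 := by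
      rw [div_lt_iff₀ hε] at h3
      have hb := D.measureReal_B_pos n
      by_contra hcon
      push Not at hcon
      have h5 : (0 : ℝ) < D.h n := Nat.cast_pos.2 (D.h_pos n)
      nlinarith
    linarith

end Construction

end

/-! ### Cyclic factors: reduction, lifting and uniform distribution. -/

section

variable {X : Type*} [MeasurableSpace X] {μ : Measure X} {T : Transformation μ}

theorem Transformation.FactorsOnto.exists_isEquivariant {κ : OdometerSeq}
    (h : T.FactorsOnto (odometer κ)) {k n : ℕ} (hk : k ∣ κ.k n) :
    ∃ φ : X → ZMod k, IsEquivariant T φ := by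
  obtain ⟨Φ, hΦ, hsemi⟩ := h
  refine ⟨fun x => ZMod.castHom hk (ZMod k) ((Φ x).1 n), ?_, ?_⟩
  · exact (Measurable.of_discrete (f := ZMod.castHom hk (ZMod k))).comp
      ((measurable_pi_apply n).comp (measurable_subtype_coe.comp hΦ.measurable))
  · filter_upwards [hsemi] with x hx
    rw [hx, ← map_one (ZMod.castHom hk (ZMod k)), ← map_add]
    rfl

/-- An equivariant map to `ℤ / kℤ` lifts to one to `ℤ / lℤ` for a multiple `l` of `k` if there is
any equivariant map to `ℤ / lℤ`. -/
theorem IsEquivariant.exists_lift (hT : Ergodic T.toFun μ) {k l : ℕ} [NeZero k] (hkl : k ∣ l)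
    {φ : X → ZMod k} (hφ : IsEquivariant T φ) {ψ : X → ZMod l} (hψ : IsEquivariant T ψ) :
    ∃ ψ' : X → ZMod l, IsEquivariant T ψ' ∧
      ∀ᵐ x ∂μ, ZMod.castHom hkl (ZMod k) (ψ' x) = φ x := by
  set π := ZMod.castHom hkl (ZMod k) with hπ
  have hg : Measurable fun x => φ x - π (ψ x) :=
    (Measurable.of_discrete (f := fun p : ZMod k × ZMod k => p.1 - p.2)).comp
      (hφ.measurable.prodMk ((Measurable.of_discrete (f := π)).comp hψ.measurable))
  -- Both maps increase by 1 under `T`, so their difference is invariant, hence constant by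
  -- ergodicity; translating `ψ` by a lift `d` of that constant removes it.
  have hginv : (fun x => φ x - π (ψ x)) ∘ T.toFun =ᵐ[μ] fun x => φ x - π (ψ x) := by
    filter_upwards [hφ.apply_toFun, hψ.apply_toFun] with x h1 h2
    simp only [Function.comp_apply, h1, h2, map_add, map_one]
    ring
  obtain ⟨c, hc⟩ := hT.quasiErgodic.ae_eq_const_of_ae_eq_comp₀ hg.nullMeasurable hginv
  obtain ⟨d, hd⟩ := ZMod.castHom_surjective hkl c
  refine ⟨fun x => ψ x + d, ⟨?_, ?_⟩, ?_⟩
  · exact (Measurable.of_discrete (f := fun a : ZMod l => a + d)).comp hψ.measurable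
  · filter_upwards [hψ.apply_toFun] with x hx
    rw [hx]
    ring
  · filter_upwards [hc] with x hx
    have hx' : φ x - π (ψ x) = c := hx
    rw [map_add, hd, ← hx']
    ring

end

section

variable {X : Type*} [MeasurableSpace X] {μ : Measure X} [IsProbabilityMeasure μ]
  {T : Transformation μ}

/-- Measure preservation gives neighbouring fibres equal mass, and the `k` fibres have total mass 1.
-/
theorem IsEquivariant.measure_preimage {k : ℕ} [NeZero k] {φ : X → ZMod k}
    (h : IsEquivariant T φ) (a : ZMod k) : μ (φ ⁻¹' {a}) = (k : ℝ≥0∞)⁻¹ := by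
  have hsucc : ∀ a, μ (φ ⁻¹' {a + 1}) = μ (φ ⁻¹' {a}) := by
    intro a
    rw [← T.measurePreserving_toFun.measure_preimage (h.measurableSet {a + 1}).nullMeasurableSet]
    refine measure_congr (Filter.eventuallyEq_set.2 ?_)
    filter_upwards [h.apply_toFun] with x hx
    simp [hx]
  have hnat : ∀ n : ℕ, μ (φ ⁻¹' {(n : ZMod k)}) = μ (φ ⁻¹' {0}) := by
    intro n
    induction n with
    | zero => rw [Nat.cast_zero]
    | succ n ih => rw [Nat.cast_succ, hsucc, ih]
  have hall : ∀ b, μ (φ ⁻¹' {b}) = μ (φ ⁻¹' {a}) := by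
    intro b
    rw [← ZMod.natCast_zmod_val b, ← ZMod.natCast_zmod_val a, hnat, hnat]
  have hsum : ∑ b, μ (φ ⁻¹' {b}) = 1 := by
    rw [sum_measure_preimage_singleton _ fun b _ => h.measurableSet {b}]
    simp
  rw [Finset.sum_congr rfl fun b _ => hall b, Finset.sum_const, Finset.card_univ, ZMod.card,
    nsmul_eq_mul, mul_comm] at hsum
  exact ENNReal.eq_inv_of_mul_eq_one_left hsum

theorem IsEquivariant.factorsOnto {k : ℕ} [NeZero k] {φ : X → ZMod k} (h : IsEquivariant T φ) :
    T.FactorsOnto (cyclic k) := by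
  refine ⟨φ, ⟨h.measurable, ?_⟩, h.apply_toFun⟩
  refine Measure.ext_of_singleton fun a => ?_
  rw [Measure.map_apply h.measurable (measurableSet_singleton a), h.measure_preimage]
  simp [cyclicMeasure]

theorem factorsOnto_cyclic_iff {k : ℕ} [NeZero k] :
    T.FactorsOnto (cyclic k) ↔ ∃ φ : X → ZMod k, IsEquivariant T φ :=
  ⟨fun ⟨φ, h⟩ => ⟨φ, h.measurePreserving.measurable, h.semiconj⟩, fun ⟨_, h⟩ => h.factorsOnto⟩

end

/-! ### Cylinder sets of the odometer. -/

namespace OdometerSeq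

variable (κ : OdometerSeq)

theorem mem_space_of_succ {α : ∀ n, ZMod (κ.k n)}
    (h : ∀ n, ZMod.castHom (κ.dvd_succ n) (ZMod (κ.k n)) (α (n + 1)) = α n) : α ∈ κ.space := by
  intro m n hmn
  induction n, hmn using Nat.le_induction with
  | base => rw [ZMod.castHom_self]; rfl
  | succ n hmn ih =>
    rw [← ih, ← h n, ← RingHom.comp_apply, ZMod.castHom_comp]

/-- The cylinder sets. -/
def cylinders : Set (Set κ.space) := {s | ∃ n, ∃ i : ZMod (κ.k n), s = {α | α.1 n = i}}

/-- A later coordinate determines all earlier ones, so two cylinders are disjoint or nested. -/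
theorem isPiSystem_cylinders : IsPiSystem κ.cylinders := by
  have key : ∀ m n (i : ZMod (κ.k m)) (j : ZMod (κ.k n)), m ≤ n →
      ({α : κ.space | α.1 m = i} ∩ {α : κ.space | α.1 n = j}).Nonempty →
      {α : κ.space | α.1 m = i} ∩ {α : κ.space | α.1 n = j} = {α : κ.space | α.1 n = j} := by
    rintro m n i j hmn ⟨β, hβi, hβj⟩
    refine inter_eq_right.2 fun α hα => ?_
    have h1 := α.2 m n hmn
    have h2 := β.2 m n hmn
    have hα' : α.1 n = j := hα
    have hβj' : β.1 n = j := hβj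
    rw [hα', ← hβj', h2] at h1
    exact h1.symm.trans hβi
  rintro _ ⟨m, i, rfl⟩ _ ⟨n, j, rfl⟩ hne
  rcases le_total m n with hmn | hmn
  · exact ⟨n, j, key m n i j hmn hne⟩
  · rw [inter_comm] at hne ⊢
    exact ⟨m, i, key n m j i hmn hne⟩

theorem measurableSet_of_mem_cylinders {s : Set κ.space} (hs : s ∈ κ.cylinders) :
    MeasurableSet s := by
  obtain ⟨n, i, rfl⟩ := hs
  exact measurableSet_eq_fun ((measurable_pi_apply n).comp measurable_subtype_coe) measurable_const

theorem generateFrom_cylinders :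
    (inferInstance : MeasurableSpace κ.space) = MeasurableSpace.generateFrom κ.cylinders := by
  refine le_antisymm ?_ (MeasurableSpace.generateFrom_le fun s => κ.measurableSet_of_mem_cylinders)
  have h : @Measurable _ _ (MeasurableSpace.generateFrom κ.cylinders) _
      (Subtype.val : κ.space → ∀ n, ZMod (κ.k n)) := by
    refine @measurable_pi_lambda _ _ _ (MeasurableSpace.generateFrom κ.cylinders) _ _ fun n => ?_
    refine @measurable_to_countable' _ _ _ _ (MeasurableSpace.generateFrom κ.cylinders) _ fun i => ?_
    exact MeasurableSpace.measurableSet_generateFrom ⟨n, i, rfl⟩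
  exact h.comap_le

end OdometerSeq

/-! ### Assembling the odometer factor from cyclic factors. -/

section

variable {X : Type*} [MeasurableSpace X] {μ : Measure X} [IsProbabilityMeasure μ]
  {T : Transformation μ}

theorem factorsOnto_odometer (hT : Ergodic T.toFun μ) {κ : OdometerSeq}
    (h : ∀ n, ∃ φ : X → ZMod (κ.k n), IsEquivariant T φ) : T.FactorsOnto (odometer κ) := by
  classical
  choose φ hφ using h
  choose! next hnext using fun (n : ℕ) (f : X → ZMod (κ.k n)) (hf : IsEquivariant T f) =>
    hf.exists_lift hT (κ.dvd_succ n) (hφ (n + 1))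
  -- Each map is chosen as a lift of the previous one, so that the sequence is compatible almost
  -- everywhere.
  let ψ : ∀ n, X → ZMod (κ.k n) := fun n => Nat.rec (φ 0) next n
  have hψ : ∀ n, IsEquivariant T (ψ n) := by
    intro n
    induction n with
    | zero => exact hφ 0
    | succ n ih => exact (hnext n (ψ n) ih).1
  have hψm : Measurable fun x n => ψ n x := measurable_pi_lambda _ fun n => (hψ n).measurable
  have hspace : ∀ᵐ x ∂μ, (fun n => ψ n x) ∈ κ.space := by
    filter_upwards [ae_all_iff.2 fun n => (hnext n (ψ n) (hψ n)).2] with x hx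
    exact κ.mem_space_of_succ hx
  have hsm : MeasurableSet {x | (fun n => ψ n x) ∈ κ.space} :=
    hψm κ.isClosed_space.measurableSet
  -- The value `0` is used only on the null set where compatibility fails.
  let Φ : X → κ.space := fun x => if hx : (fun n => ψ n x) ∈ κ.space then ⟨_, hx⟩ else 0
  have hΦval : ∀ x, (fun n => ψ n x) ∈ κ.space → (Φ x).1 = fun n => ψ n x := by
    intro x hx
    simp only [Φ, dif_pos hx]
  have hΦm : Measurable Φ := by
    refine Measurable.dite (s := {x | (fun n => ψ n x) ∈ κ.space})
      (f := fun x : {x | (fun n => ψ n x) ∈ κ.space} => (⟨fun n => ψ n x, x.2⟩ : κ.space)) ?_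
      (g := fun _ => 0) measurable_const hsm
    exact (hψm.comp measurable_subtype_coe).subtype_mk
  refine ⟨Φ, ⟨hΦm, ?_⟩, ?_⟩
  · have : IsProbabilityMeasure (μ.map Φ) := Measure.isProbabilityMeasure_map hΦm.aemeasurable
    -- Both measures give mass `1 / k_n` to a cylinder at coordinate `n`, and cylinders form a
    -- generating π-system.
    refine ext_of_generate_finite κ.cylinders κ.generateFrom_cylinders κ.isPiSystem_cylinders ?_ ?_
    · rintro _ ⟨n, i, rfl⟩
      rw [Measure.map_apply hΦm (κ.measurableSet_of_mem_cylinders ⟨n, i, rfl⟩),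
        κ.measure_cylinder, ← (hψ n).measure_preimage i]
      refine measure_congr (Filter.eventuallyEq_set.2 ?_)
      filter_upwards [hspace] with x hx
      simp only [mem_preimage, mem_ofPred_eq, hΦval x hx, mem_singleton_iff]
    · rw [measure_univ]
      exact (Measure.addHaarMeasure_self (K₀ := (⊤ : TopologicalSpace.PositiveCompacts κ.space))).symm
  · filter_upwards [hspace, T.measurePreserving_toFun.quasiMeasurePreserving.ae hspace,
      ae_all_iff.2 fun n => (hψ n).apply_toFun] with x h1 h2 h3
    refine Subtype.ext ?_
    rw [hΦval _ h2]
    ext n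
    rw [h3]
    change _ = (Φ x).1 n + 1
    rw [hΦval _ h1]

end

end RankOne

theorem mainTheorem4 {X : Type*} [MeasurableSpace X] (μ : MeasureTheory.Measure X)
    [MeasureTheory.IsProbabilityMeasure μ]
    (T : RankOne.Transformation μ) (D : RankOne.Construction T)
    (K : Set ℕ) (κ : RankOne.OdometerSeq) (hK : K = ⋃ n, {m : ℕ | m ∣ κ.k n}) :
    List.TFAE [
      T.FactorsOnto (RankOne.odometer κ),
      ∀ k ∈ K, ∀ η : ℝ, 0 < η → ∃ N : ℕ, ∀ m n : ℕ, N ≤ m → m ≤ n → ∃ j : ZMod k,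
        (((D.I m n).filter fun i : ℕ => (i : ZMod k) ≠ j).card : ℝ) / ((D.I m n).card : ℝ) < η,
      ∀ k ∈ K, T.FactorsOnto (RankOne.cyclic k)] := by
  have hmem : ∀ {k}, k ∈ K ↔ ∃ n, k ∣ κ.k n := by simp [hK]
  -- This excludes `ZMod 0 = ℤ`, on which the counting arguments would fail.
  have hne : ∀ {k}, k ∈ K → NeZero k := fun hk => by
    obtain ⟨n, hn⟩ := hmem.1 hk
    exact ⟨ne_zero_of_dvd_ne_zero (NeZero.ne (κ.k n)) hn⟩
  tfae_have 1 → 3 := fun h k hk => by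
    have := hne hk
    obtain ⟨n, hn⟩ := hmem.1 hk
    exact RankOne.factorsOnto_cyclic_iff.2 (h.exists_isEquivariant hn)
  tfae_have 3 → 1 := fun h => RankOne.factorsOnto_odometer D.ergodic fun n =>
    RankOne.factorsOnto_cyclic_iff.1 (h _ (hmem.2 ⟨n, dvd_rfl⟩))
  tfae_have 3 → 2 := fun h k hk η hη => by
    have := hne hk
    obtain ⟨φ, hφ⟩ := RankOne.factorsOnto_cyclic_iff.1 (h k hk)
    exact hφ.exists_card_filter_div_lt D hη
  tfae_have 2 → 3 := fun h k hk => by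
    have := hne hk
    exact RankOne.factorsOnto_cyclic_iff.2 (D.exists_isEquivariant (h k hk))
  tfae_finish
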